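/- Let $\mathbb{T}^n=\mathbb{R}^n/\mathbb{Z}^n$ with $n\ge 0$. A *toric hyperplane* is a set $\theta^{-1}(b)\subseteq\mathbb{T}^n$, where $\theta:\mathbb{T}^n\to S^1=\mathbb{R}/\mathbb{Z}$ is a continuous surjective group homomorphism and $b\in S^1$ (it need not be connected), and a *toric arrangement* $\mathcal{A}$ is a finite set of toric hyperplanes in $\mathbb{T}^n$. The arrangement is *in general position* if any $m\le n$ distinct hyperplanes of $\mathcal{A}$ have an intersection of dimension at most $n-m$ (an empty intersection being allowed), and any $m>n$ distinct hyperplanes of $\mathcal{A}$ have empty intersection. It is *spanning* if some $n$ distinct hyperplanes of $\mathcal{A}$ have a common point. Let $L(\mathcal{A})$ be the intersection poset: the set of connected components of non-empty intersections of hyperplanes of $\mathcal{A}$, including $\mathbb{T}^n$ as the intersection of the empty family, ordered by reverse inclusion. Let $\mu$ be its Möbius function, write $\mu(x)=\mu(\mathbb{T}^n,x)$, and let $$\chi_{\mathcal{A}}(t)=\sum_{x\in L(\mathcal{A})}\mu(x)\,t^{\dim x}$$ be the characteristic polynomial. Let $f_n(\mathcal{A})$ be the number of regions of $\mathcal{A}$,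 that is, of connected components of $\mathbb{T}^n\setminus\bigcup_{H\in\mathcal{A}}H$. **Proposition.** If $\mathcal{A}$ is spanning and in general position, then $L(\mathcal{A})$ and the set of regions are finite and $$f_n(\mathcal{A})=(-1)^n\,\chi_{\mathcal{A}}(0).$$ -/

import Mathlib

noncomputable section

/-- The `n`-torus `ℝⁿ / ℤⁿ`, as a topological group. -/
abbrev Torus (n : ℕ) : Type := UnitAddTorus (Fin n)

/-- The projection `ℝⁿ → ℝⁿ / ℤⁿ`. -/
def torusProj {n : ℕ} (v : Fin n → ℝ) : Torus n := fun i => (v i : UnitAddCircle)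

/-- An (affine) toric hyperplane: the preimage of a point of the circle under a continuous
surjective group homomorphism from the torus to the circle. It need not be connected. -/
def IsToricHyperplane {n : ℕ} (H : Set (Torus n)) : Prop :=
  ∃ (θ : Torus n →ₜ+ UnitAddCircle) (b : UnitAddCircle),
    Function.Surjective θ ∧ H = θ ⁻¹' {b}

/-- A toric hyperplane arrangement: a finite set of toric hyperplanes. -/
structure ToricArrangement (n : ℕ) where
  hyperplanes : Finset (Set (Torus n))
  isToricHyperplane : ∀ H ∈ hyperplanes, IsToricHyperplane H

/-- The directions in `ℝⁿ` along which a subset `X` of the torus is invariant under translation. If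
`X` is a coset of a closed subgroup `G` (as is every non-empty intersection of toric hyperplanes, and
every connected component of such an intersection), this is the Lie algebra of `G`, that is, the
tangent space of `X`. -/
def tangentDirections {n : ℕ} (X : Set (Torus n)) : Submodule ℝ (Fin n → ℝ) where
  carrier := {v | ∀ p ∈ X, ∀ t : ℝ, p + torusProj (t • v) ∈ X}
  add_mem' := by
    intro v w hv hw p hp t
    have h := hw _ (hv p hp t) t
    have e : p + torusProj (t • v) + torusProj (t • w) = p + torusProj (t • (v + w)) := by
      funext i
      simp [torusProj, add_assoc]
    rwa [e] at h
  zero_mem' := by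
    intro p hp t
    have e : p + torusProj (t • (0 : Fin n → ℝ)) = p := by
      funext i
      simp [torusProj]
    rwa [e]
  smul_mem' := by
    intro c v hv p hp t
    rw [smul_smul]
    exact hv p hp (t * c)

/-- The dimension of a non-empty subset of the torus that is a coset of a closed subgroup. -/
def torusDim {n : ℕ} (X : Set (Torus n)) : ℕ := Module.finrank ℝ (tangentDirections X)

namespace ToricArrangement

variable {n : ℕ} (A : ToricArrangement n)

/-- General position: `m ≤ n` hyperplanes of the arrangement meet in dimension at most `n - m` (the
empty set, having dimension `-∞`, is allowed), and more than `n` of them never meet. -/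
def IsGeneralPosition : Prop :=
  ∀ S : Finset (Set (Torus n)), S ⊆ A.hyperplanes →
    (S.card ≤ n → (⋂ H ∈ S, H).Nonempty → torusDim (⋂ H ∈ S, H) ≤ n - S.card) ∧
    (n < S.card → (⋂ H ∈ S, H) = ∅)

/-- Spanning: some `n` hyperplanes of the arrangement have a common point. -/
def IsSpanning : Prop :=
  ∃ S : Finset (Set (Torus n)), S ⊆ A.hyperplanes ∧ S.card = n ∧ (⋂ H ∈ S, H).Nonempty

/-- The set of regions: the connected components of the complement of the hyperplanes. -/
abbrev Regions : Type := ConnectedComponents ↥((⋃ H ∈ A.hyperplanes, H)ᶜ : Set (Torus n))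

/-- The number of regions (`n`-flats). -/
def numRegions : ℕ := Nat.card A.Regions

/-- The intersection poset: the connected components of the non-empty intersections of hyperplanes
of the arrangement (the torus itself being the intersection over the empty set). -/
def IntersectionPoset : Type :=
  {X : Set (Torus n) // ∃ S : Finset (Set (Torus n)), S ⊆ A.hyperplanes ∧
    ∃ p ∈ ⋂ H ∈ S, H, X = connectedComponentIn (⋂ H ∈ S, H) p}

namespace IntersectionPoset

variable {A}

/-- The order is reverse inclusion. -/
instance : PartialOrder A.IntersectionPoset where
  le X Y := Y.1 ⊆ X.1
  le_refl X := subset_rfl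
  le_trans X Y Z hXY hYZ := Set.Subset.trans hYZ hXY
  le_antisymm X Y hXY hYX := Subtype.ext (Set.Subset.antisymm hYX hXY)

theorem le_iff {X Y : A.IntersectionPoset} : X ≤ Y ↔ Y.1 ⊆ X.1 := Iff.rfl

/-- The minimum element is the whole torus. -/
instance : OrderBot A.IntersectionPoset where
  bot := ⟨Set.univ, ∅, by simp, 0, by simp, by
    simp [connectedComponentIn_univ, PreconnectedSpace.connectedComponent_eq_univ]⟩
  bot_le X := Set.subset_univ X.1

theorem coe_bot : (⊥ : A.IntersectionPoset).1 = Set.univ := rfl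

theorem finite_Iic (Y : A.IntersectionPoset) : (Set.Iic Y).Finite := by
  classical
  obtain ⟨p, hp⟩ : Y.1.Nonempty := by
    obtain ⟨S, -, p, hp, h⟩ := Y.2
    exact ⟨p, h ▸ mem_connectedComponentIn hp⟩
  refine Set.Finite.of_finite_image (f := Subtype.val) ?_ Subtype.val_injective.injOn
  refine ((A.hyperplanes.powerset.finite_toSet).image
    fun S => connectedComponentIn (⋂ H ∈ S, H) p).subset ?_
  rintro _ ⟨X, hX, rfl⟩
  obtain ⟨S, hS, q, hq, h⟩ := X.2
  refine ⟨S, by simpa using hS, ?_⟩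
  have hpX : p ∈ X.1 := hX hp
  rw [h] at hpX ⊢
  exact (connectedComponentIn_eq hpX).symm

instance : LocallyFiniteOrder A.IntersectionPoset :=
  LocallyFiniteOrder.ofFiniteIcc fun _ Y => (finite_Iic Y).subset Set.Icc_subset_Iic_self

/-- The Möbius function `μ(X) = μ(0̂, X)` of the intersection poset. -/
def moebius (X : A.IntersectionPoset) : ℤ :=
  letI := Classical.decEq A.IntersectionPoset
  IncidenceAlgebra.mu ℤ (⊥ : A.IntersectionPoset) X

end IntersectionPoset

/-- The characteristic polynomial `∑ μ(X) t ^ dim X`, the sum being over the intersection poset. -/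
def charPoly : Polynomial ℤ :=
  ∑ᶠ X : A.IntersectionPoset, Polynomial.C X.moebius * Polynomial.X ^ torusDim X.1

end ToricArrangement

end

/-! Both sides count vertices: the points of the torus at which the normals of the hyperplanes
through them span the dual of ℝⁿ.

At t = 0 only zero-dimensional flats contribute to the characteristic polynomial, and these are the
vertices. General position makes the normals of hyperplanes with a common point linearly
independent. The interval below a flat is therefore the Boolean lattice on the hyperplanes that
define it, and μ = (-1)^n at a vertex (`moebius_flat`, `neg_one_pow_mul_eval_charPoly`).

For the regions, pass to ℝⁿ, where the hyperplanes become `a i x ∈ b i + ℤ` and each region is the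
image of an open cell. Spanning makes closed cells compact, so a linear functional ℓ has a minimum
on each. Choose ℓ outside every proper span of normals. The tight normals at a minimiser then form a
basis, so the minimiser lies over a vertex, and the signs of the (nonzero) coefficients of ℓ in this
basis tell on which side of each tight hyperplane the cell lies. Hence a cell has only one minimiser
(`IsCellMin.eq`), and a lifted vertex minimises ℓ on exactly one cell
(`exists_isCellMin_of_span_tightSet`, `IsCellMin.label_eq`). ℓ need not descend to the torus, but a
lattice translation changes it by a constant, so the matching does descend
(`nonempty_regions_equiv`). -/

open Set Filter Topology Module

/-! ### Periodic affine arrangements: cells and minimisers of a generic functional -/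

section PeriodicArrangement

variable {ι E : Type*} [AddCommGroup E] [Module ℝ E]

/-- The closed cell of the periodic arrangement `a i x ∈ b i + ℤ` with integer label `k`. -/
def closedCell (a : ι → Dual ℝ E) (b : ι → ℝ) (k : ι → ℤ) : Set E :=
  {x | ∀ i, b i + k i ≤ a i x ∧ a i x ≤ b i + k i + 1}

/-- The open cell of the periodic arrangement `a i x ∈ b i + ℤ` with integer label `k`. -/
def openCell (a : ι → Dual ℝ E) (b : ι → ℝ) (k : ι → ℤ) : Set E :=
  {x | ∀ i, b i + k i < a i x ∧ a i x < b i + k i + 1}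

/-- The indices of the hyperplane families of a periodic arrangement that pass through `x`. -/
def tightSet (a : ι → Dual ℝ E) (b : ι → ℝ) (x : E) : Set ι :=
  {i | ∃ m : ℤ, a i x = b i + m}

/-- `v` minimises `ℓ` on the closed cell labelled `k`. -/
def IsCellMin (a : ι → Dual ℝ E) (b : ι → ℝ) (ℓ : Dual ℝ E) (k : ι → ℤ) (v : E) : Prop :=
  v ∈ closedCell a b k ∧ ∀ x ∈ closedCell a b k, ℓ v ≤ ℓ x

/-- A functional which lies in the span of a subfamily only if that subfamily spans. -/
def IsGenericFor (a : ι → Dual ℝ E) (ℓ : Dual ℝ E) : Prop :=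
  ∀ s : Set ι, ℓ ∈ Submodule.span ℝ (a '' s) → Submodule.span ℝ (a '' s) = ⊤

/-- A real vector space is not a finite union of proper subspaces, here the proper spans of
subfamilies. -/
theorem exists_isGenericFor [Finite ι] (a : ι → Dual ℝ E) : ∃ ℓ, IsGenericFor a ℓ := by
  by_contra! h
  let p : {s : Set ι // Submodule.span ℝ (a '' s) ≠ ⊤} → Submodule ℝ (Dual ℝ E) :=
    fun s => Submodule.span ℝ (a '' s.1)
  have hc : ⋃ i, (p i : Set (Dual ℝ E)) = Set.univ := by
    refine eq_univ_of_forall fun ℓ => ?_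
    have := h ℓ
    simp only [IsGenericFor, not_forall] at this
    obtain ⟨s, hs, hs'⟩ := this
    exact mem_iUnion.2 ⟨⟨s, hs'⟩, hs⟩
  obtain ⟨i, hi⟩ := Subspace.exists_eq_top_of_iUnion_eq_univ hc
  exact i.2 hi

theorem eventually_le_add_mul {l x y : ℝ} (h : l ≤ x) (hy : x = l → 0 ≤ y) :
    ∀ᶠ ε in 𝓝[>] (0 : ℝ), l ≤ x + ε * y := by
  rcases h.eq_or_lt with rfl | h
  · filter_upwards [self_mem_nhdsWithin] with ε hε
    have := mul_nonneg (le_of_lt hε) (hy rfl)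
    linarith
  · have : Tendsto (fun ε : ℝ => x + ε * y) (𝓝[>] 0) (𝓝 (x + 0 * y)) :=
      (Continuous.tendsto (by fun_prop) 0).mono_left nhdsWithin_le_nhds
    filter_upwards [this.eventually_const_lt (by simpa using h)] with ε hε using hε.le

theorem eventually_lt_add_mul {l x y : ℝ} (h : l ≤ x) (hy : x = l → 0 < y) :
    ∀ᶠ ε in 𝓝[>] (0 : ℝ), l < x + ε * y := by
  rcases h.eq_or_lt with rfl | h
  · filter_upwards [self_mem_nhdsWithin] with ε hε
    have := mul_pos hε (hy rfl)
    linarith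
  · have : Tendsto (fun ε : ℝ => x + ε * y) (𝓝[>] 0) (𝓝 (x + 0 * y)) :=
      (Continuous.tendsto (by fun_prop) 0).mono_left nhdsWithin_le_nhds
    exact this.eventually_const_lt (by simpa using h)

variable {a : ι → Dual ℝ E} {b : ι → ℝ} {ℓ : Dual ℝ E} {k : ι → ℤ} {v w : E}

theorem openCell_subset_closedCell : openCell a b k ⊆ closedCell a b k :=
  fun _ hx i => ⟨(hx i).1.le, (hx i).2.le⟩

theorem convex_openCell : Convex ℝ (openCell a b k) := by
  have : openCell a b k = ⋂ i, a i ⁻¹' Ioo (b i + k i) (b i + k i + 1) := by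
    ext x; simp [openCell]
  rw [this]
  exact convex_iInter fun i => (convex_Ioo _ _).linear_preimage (a i)

/-- Strict inequalities survive a small step, so only the tight walls constrain the direction. -/
theorem exists_add_smul_mem_closedCell [Finite ι] (hv : v ∈ closedCell a b k)
    (h₁ : ∀ i, a i v = b i + k i → 0 ≤ a i w) (h₂ : ∀ i, a i v = b i + k i + 1 → a i w ≤ 0) :
    ∃ ε > (0 : ℝ), v + ε • w ∈ closedCell a b k := by
  have h : ∀ᶠ ε in 𝓝[>] (0 : ℝ), ∀ i, b i + k i ≤ a i v + ε * a i w ∧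
      -(b i + k i + 1) ≤ -a i v + ε * -a i w := by
    refine eventually_all.2 fun i => ?_
    refine (eventually_le_add_mul (hv i).1 (h₁ i)).and
      (eventually_le_add_mul (neg_le_neg (hv i).2) fun e => ?_)
    have := h₂ i (neg_injective e)
    linarith
  obtain ⟨ε, hε, h0⟩ := (h.and self_mem_nhdsWithin).exists
  refine ⟨ε, h0, fun i => ?_⟩
  have := hε i
  simp only [map_add, map_smul, smul_eq_mul]
  constructor <;> linarith

theorem exists_add_smul_mem_openCell [Finite ι] (hv : v ∈ closedCell a b k)
    (h₁ : ∀ i, a i v = b i + k i → 0 < a i w) (h₂ : ∀ i, a i v = b i + k i + 1 → a i w < 0) :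
    ∃ ε > (0 : ℝ), v + ε • w ∈ openCell a b k := by
  have h : ∀ᶠ ε in 𝓝[>] (0 : ℝ), ∀ i, b i + k i < a i v + ε * a i w ∧
      -(b i + k i + 1) < -a i v + ε * -a i w := by
    refine eventually_all.2 fun i => ?_
    refine (eventually_lt_add_mul (hv i).1 (h₁ i)).and
      (eventually_lt_add_mul (neg_le_neg (hv i).2) fun e => ?_)
    have := h₂ i (neg_injective e)
    linarith
  obtain ⟨ε, hε, h0⟩ := (h.and self_mem_nhdsWithin).exists
  refine ⟨ε, h0, fun i => ?_⟩
  have := hε i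
  simp only [map_add, map_smul, smul_eq_mul]
  constructor <;> linarith

theorem mem_tightSet_of_eq {i : ι} (h : a i v = b i + k i) : i ∈ tightSet a b v := ⟨k i, h⟩

theorem mem_tightSet_of_eq_add_one {i : ι} (h : a i v = b i + k i + 1) : i ∈ tightSet a b v :=
  ⟨k i + 1, by rw [h]; push_cast; ring⟩

theorem eq_or_eq_of_mem_tightSet {i : ι} (hv : v ∈ closedCell a b k) (hi : i ∈ tightSet a b v) :
    a i v = b i + k i ∨ a i v = b i + k i + 1 := by
  obtain ⟨m, hm⟩ := hi
  obtain ⟨h1, h2⟩ := hv i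
  rw [hm] at h1 h2
  have h1' : k i ≤ m := by exact_mod_cast (by linarith : (k i : ℝ) ≤ m)
  have h2' : m ≤ k i + 1 := by exact_mod_cast (by linarith : (m : ℝ) ≤ k i + 1)
  rcases h1'.eq_or_lt with h | h
  · left; rw [hm, h]
  · right
    have : m = k i + 1 := by omega
    rw [hm, this]; push_cast; ring

theorem mem_openCell_floor (h : tightSet a b v = ∅) : v ∈ openCell a b fun i => ⌊a i v - b i⌋ := by
  intro i
  have h1 := Int.floor_le (a i v - b i)
  have h2 := Int.lt_floor_add_one (a i v - b i)
  have h3 : (⌊a i v - b i⌋ : ℝ) ≠ a i v - b i := fun e => by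
    have : i ∈ tightSet a b v := ⟨⌊a i v - b i⌋, by rw [e]; ring⟩
    simp [h] at this
  refine ⟨?_, by linarith⟩
  have := lt_of_le_of_ne h1 h3
  linarith

theorem label_eq_of_mem_openCell {k' : ι → ℤ} (h : v ∈ openCell a b k) (h' : v ∈ openCell a b k') :
    k = k' := by
  funext i
  have h1 := h i
  have h2 := h' i
  have h3 : k i < k' i + 1 := by exact_mod_cast (by linarith : (k i : ℝ) < k' i + 1)
  have h4 : k' i < k i + 1 := by exact_mod_cast (by linarith : (k' i : ℝ) < k i + 1)
  omega

theorem tightSet_eq_empty_of_mem_openCell (h : v ∈ openCell a b k) : tightSet a b v = ∅ := by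
  refine eq_empty_of_forall_notMem fun i hi => ?_
  have := h i
  rcases eq_or_eq_of_mem_tightSet (openCell_subset_closedCell h) hi with h | h <;> linarith

/-- First-order condition: along a direction killed by all tight normals one can move both ways
inside the cell, so ℓ vanishes on it; duality then puts ℓ in the span. -/
theorem IsCellMin.mem_span [Finite ι] (h : IsCellMin a b ℓ k v) :
    ℓ ∈ Submodule.span ℝ (a '' tightSet a b v) := by
  have key : ∀ w, (∀ i ∈ tightSet a b v, a i w = 0) → 0 ≤ ℓ w := by
    intro w hw
    obtain ⟨ε, hε, hm⟩ := exists_add_smul_mem_closedCell (w := w) h.1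
      (fun i hi => (hw i (mem_tightSet_of_eq hi)).ge)
      (fun i hi => (hw i (mem_tightSet_of_eq_add_one hi)).le)
    have := h.2 _ hm
    simp only [map_add, map_smul, smul_eq_mul] at this
    exact nonneg_of_mul_nonneg_right (by linarith : 0 ≤ ε * ℓ w) hε
  have hle : ⨅ i : tightSet a b v, LinearMap.ker (a i) ≤ LinearMap.ker ℓ := by
    intro w hw
    simp only [Submodule.mem_iInf, LinearMap.mem_ker, Subtype.forall] at hw
    have h1 := key w hw
    have h2 := key (-w) fun i hi => by rw [map_neg, hw i hi, neg_zero]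
    rw [map_neg] at h2
    rw [LinearMap.mem_ker]; linarith
  have := mem_span_of_iInf_ker_le_ker hle
  rwa [Set.image_eq_range]

/-- The sign condition makes every term `c i * a i` minimal at `v` separately. -/
theorem IsCellMin.of_sign (hv : v ∈ closedCell a b k) {c : ι →₀ ℝ}
    (hcl : ∀ x, ℓ x = ∑ i ∈ c.support, c i * a i x)
    (h : ∀ i ∈ c.support,
      (a i v = b i + k i ∧ 0 < c i) ∨ (a i v = b i + k i + 1 ∧ c i < 0)) :
    IsCellMin a b ℓ k v := by
  refine ⟨hv, fun x hx => ?_⟩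
  rw [hcl, hcl]
  refine Finset.sum_le_sum fun i hi => ?_
  rcases h i hi with ⟨e, hci⟩ | ⟨e, hci⟩
  · exact mul_le_mul_of_nonneg_left (e ▸ (hx i).1) hci.le
  · exact mul_le_mul_of_nonpos_left (e ▸ (hx i).2) hci.le

theorem IsCellMin.tight_span [Finite ι] (hℓ : IsGenericFor a ℓ) (h : IsCellMin a b ℓ k v) :
    Submodule.span ℝ (a '' tightSet a b v) = ⊤ := hℓ _ h.mem_span

/-- No coefficient in the basis vanishes: otherwise ℓ would lie in the span of a smaller subfamily,
which by genericity would already span, against independence. -/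
theorem IsGenericFor.exists_coeff (hℓ : IsGenericFor a ℓ) {s : Set ι} (hs : LinearIndepOn ℝ a s)
    (hspan : Submodule.span ℝ (a '' s) = ⊤) :
    ∃ c : ι →₀ ℝ, (c.support : Set ι) = s ∧ ∀ x, ℓ x = ∑ i ∈ c.support, c i * a i x := by
  have hmem : ℓ ∈ Submodule.span ℝ (a '' s) := hspan ▸ Submodule.mem_top
  obtain ⟨c, hc, hcl⟩ := (Finsupp.mem_span_image_iff_linearCombination ℝ).1 hmem
  refine ⟨c, ?_, fun x => ?_⟩
  · refine Subset.antisymm hc fun i hi => ?_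
    have h1 : ℓ ∈ Submodule.span ℝ (a '' (c.support : Set ι)) :=
      (Finsupp.mem_span_image_iff_linearCombination ℝ).2 ⟨c, (Finsupp.mem_supported ℝ c).2 subset_rfl, hcl⟩
    have h2 := hℓ _ h1
    by_contra hi'
    refine LinearIndepOn.notMem_span hs hi ?_
    refine Submodule.span_mono (image_mono ?_) (h2 ▸ Submodule.mem_top (x := a i))
    exact fun j hj => ⟨hc hj, fun e => hi' (by rwa [mem_singleton_iff.1 e] at hj)⟩
  · rw [← hcl, Finsupp.linearCombination_apply, Finsupp.sum, LinearMap.sum_apply]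
    simp

variable [FiniteDimensional ℝ E]

theorem exists_forall_mem_apply_eq {s : Set ι} (hs : LinearIndepOn ℝ a s)
    (hspan : Submodule.span ℝ (a '' s) = ⊤) (f : ι → ℝ) : ∃ x, ∀ i ∈ s, a i x = f i := by
  rw [Set.image_eq_range] at hspan
  let β : Basis s ℝ (Dual ℝ E) := Basis.mk hs hspan.ge
  let F : Dual ℝ (Dual ℝ E) := β.constr ℝ fun i => f i
  refine ⟨(evalEquiv ℝ E).symm F, fun i hi => ?_⟩
  have h1 : a i = β ⟨i, hi⟩ := by
    exact (Basis.mk_apply hs hspan.ge ⟨i, hi⟩).symm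
  rw [← Module.Dual.eval_apply ℝ E ((evalEquiv ℝ E).symm F) (a i)]
  have h2 : Dual.eval ℝ E ((evalEquiv ℝ E).symm F) = F := (evalEquiv ℝ E).apply_symm_apply F
  rw [h2, h1, Basis.constr_basis]

theorem eq_zero_of_forall_apply_eq_zero {s : Set ι}
    (hspan : Submodule.span ℝ (a '' s) = ⊤) {x : E} (hx : ∀ i ∈ s, a i x = 0) : x = 0 := by
  rw [← Module.forall_dual_apply_eq_zero_iff ℝ x]
  intro φ
  have hφ : φ ∈ Submodule.span ℝ (a '' s) := hspan ▸ Submodule.mem_top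
  induction hφ using Submodule.span_induction with
  | mem y hy => obtain ⟨i, hi, rfl⟩ := hy; exact hx i hi
  | zero => simp
  | add y z _ _ hy hz => simp [hy, hz]
  | smul c y _ hy => simp [hy]

/-- At a vertex, being the minimiser of a generic functional on a cell is a sign condition on the
coefficients of the functional in the basis of tight normals. -/
theorem IsCellMin.sign [Finite ι] (h : IsCellMin a b ℓ k v)
    (hs : LinearIndepOn ℝ a (tightSet a b v))
    (hspan : Submodule.span ℝ (a '' tightSet a b v) = ⊤) {c : ι →₀ ℝ}
    (hc : (c.support : Set ι) = tightSet a b v) (hcl : ∀ x, ℓ x = ∑ i ∈ c.support, c i * a i x)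
    {i : ι} (hi : i ∈ tightSet a b v) :
    (a i v = b i + k i ∧ 0 < c i) ∨ (a i v = b i + k i + 1 ∧ c i < 0) := by
  classical
  have hci : c i ≠ 0 := by rw [← hc] at hi; simpa using hi
  -- Move in the dual-basis direction: `a i w = σ` and the other tight normals vanish, so ℓ changes
  -- at rate `c i * σ`.
  have key : ∀ σ : ℝ, (a i v = b i + k i → 0 ≤ σ) → (a i v = b i + k i + 1 → σ ≤ 0) →
      0 ≤ c i * σ := by
    intro σ h1 h2
    obtain ⟨w, hw⟩ := exists_forall_mem_apply_eq hs hspan (Pi.single i σ)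
    obtain ⟨ε, hε, hm⟩ := exists_add_smul_mem_closedCell (w := w) h.1
      (fun j hj => by
        rw [hw j (mem_tightSet_of_eq hj)]
        by_cases e : j = i
        · subst e; simpa using h1 hj
        · simp [e])
      (fun j hj => by
        rw [hw j (mem_tightSet_of_eq_add_one hj)]
        by_cases e : j = i
        · subst e; simpa using h2 hj
        · simp [e])
    have h3 := h.2 _ hm
    simp only [map_add, map_smul, smul_eq_mul] at h3
    have h4 : 0 ≤ ℓ w := nonneg_of_mul_nonneg_right (by linarith : 0 ≤ ε * ℓ w) hε
    rw [hcl, Finset.sum_eq_single i] at h4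
    · rwa [hw i hi, Pi.single_eq_same] at h4
    · intro j hj hji
      rw [hw j (hc ▸ hj), Pi.single_eq_of_ne hji, mul_zero]
    · intro hi'
      exact absurd (by rwa [← hc] at hi) hi'
  rcases eq_or_eq_of_mem_tightSet h.1 hi with e | e
  · left
    have := key 1 (fun _ => zero_le_one) (fun e' => by linarith)
    exact ⟨e, lt_of_le_of_ne (by linarith) hci.symm⟩
  · right
    have := key (-1) (fun e' => by linarith) (fun _ => by norm_num)
    exact ⟨e, lt_of_le_of_ne (by linarith) hci⟩

/-- By the sign condition `c i * a i` is termwise at most as large at `v` as at `w`. The sums agree,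
so all terms do, and the tight normals separate points. -/
theorem IsCellMin.eq [Finite ι] (hℓ : IsGenericFor a ℓ)
    (hind : ∀ x, LinearIndepOn ℝ a (tightSet a b x))
    (h : IsCellMin a b ℓ k v) (h' : IsCellMin a b ℓ k w) : v = w := by
  have hspan := h.tight_span hℓ
  obtain ⟨c, hc, hcl⟩ := hℓ.exists_coeff (hind v) hspan
  have hle : ∀ i ∈ c.support, c i * a i v ≤ c i * a i w := by
    intro i hi
    rcases h.sign (hind v) hspan hc hcl (by rw [← hc]; exact hi) with ⟨e, hci⟩ | ⟨e, hci⟩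
    · exact mul_le_mul_of_nonneg_left (e ▸ (h'.1 i).1) hci.le
    · exact mul_le_mul_of_nonpos_left (e ▸ (h'.1 i).2) hci.le
  have heq : ∑ i ∈ c.support, c i * a i v = ∑ i ∈ c.support, c i * a i w := by
    rw [← hcl, ← hcl]
    exact le_antisymm (h.2 w h'.1) (h'.2 v h.1)
  have := (Finset.sum_eq_sum_iff_of_le hle).1 heq
  refine sub_eq_zero.1 (eq_zero_of_forall_apply_eq_zero hspan fun i hi => ?_)
  have hi' : i ∈ c.support := by rwa [← hc] at hi
  rw [map_sub, mul_left_cancel₀ (Finsupp.mem_support_iff.1 hi') (this i hi'), sub_self]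

/-- On tight indices the sign of `c i` decides the side; on the others the position of `v` strictly
between two walls fixes the label. -/
theorem IsCellMin.label_eq [Finite ι] (hℓ : IsGenericFor a ℓ)
    (hind : ∀ x, LinearIndepOn ℝ a (tightSet a b x)) {k' : ι → ℤ}
    (h : IsCellMin a b ℓ k v) (h' : IsCellMin a b ℓ k' v) : k = k' := by
  have hspan := h.tight_span hℓ
  obtain ⟨c, hc, hcl⟩ := hℓ.exists_coeff (hind v) hspan
  funext i
  by_cases hi : i ∈ tightSet a b v
  · have : (k i : ℝ) = k' i := by
      rcases h.sign (hind v) hspan hc hcl hi with ⟨e, hci⟩ | ⟨e, hci⟩ <;>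
        rcases h'.sign (hind v) hspan hc hcl hi with ⟨e', hci'⟩ | ⟨e', hci'⟩ <;> linarith
    exact_mod_cast this
  · have strict : ∀ {k : ι → ℤ}, v ∈ closedCell a b k →
        b i + k i < a i v ∧ a i v < b i + k i + 1 := fun hk =>
      ⟨lt_of_le_of_ne (hk i).1 fun e => hi (mem_tightSet_of_eq e.symm),
        lt_of_le_of_ne (hk i).2 fun e => hi (mem_tightSet_of_eq_add_one e)⟩
    have h1 := strict h.1
    have h2 := strict h'.1
    have h3 : k i < k' i + 1 := by exact_mod_cast (by linarith : (k i : ℝ) < k' i + 1)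
    have h4 : k' i < k i + 1 := by exact_mod_cast (by linarith : (k' i : ℝ) < k i + 1)
    omega

theorem exists_isCellMin_of_span_tightSet [Finite ι] (hℓ : IsGenericFor a ℓ)
    (hs : LinearIndepOn ℝ a (tightSet a b v))
    (hspan : Submodule.span ℝ (a '' tightSet a b v) = ⊤) :
    ∃ k, (openCell a b k).Nonempty ∧ IsCellMin a b ℓ k v := by
  classical
  obtain ⟨c, hc, hcl⟩ := hℓ.exists_coeff hs hspan
  -- On a tight wall the floor is exact; subtracting 1 when `c i < 0` makes that wall the upper one
  -- of the cell.
  let k : ι → ℤ := fun i =>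
    if i ∈ tightSet a b v ∧ c i < 0 then ⌊a i v - b i⌋ - 1 else ⌊a i v - b i⌋
  have hfl : ∀ i ∈ tightSet a b v, a i v = b i + ⌊a i v - b i⌋ := by
    rintro i ⟨m, hm⟩
    have : a i v - b i = m := by rw [hm]; ring
    rw [this, Int.floor_intCast, hm]
  have hkv : v ∈ closedCell a b k := by
    intro i
    by_cases hi : i ∈ tightSet a b v ∧ c i < 0
    · have := hfl i hi.1
      simp only [k, if_pos hi]
      push_cast
      constructor <;> linarith
    · simp only [k, if_neg hi]
      have h1 := Int.floor_le (a i v - b i)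
      have h2 := Int.lt_floor_add_one (a i v - b i)
      constructor <;> linarith
  have hsign : ∀ i ∈ c.support,
      (a i v = b i + k i ∧ 0 < c i) ∨ (a i v = b i + k i + 1 ∧ c i < 0) := by
    intro i hi
    have hit : i ∈ tightSet a b v := hc ▸ hi
    have := hfl i hit
    rcases (Finsupp.mem_support_iff.1 hi).lt_or_gt with h | h
    · right
      simp only [k, if_pos (And.intro hit h)]
      push_cast
      exact ⟨by linarith, h⟩
    · left
      simp only [k, if_neg (fun h' : _ ∧ _ => lt_asymm h h'.2)]
      exact ⟨this, h⟩
  have hmin := IsCellMin.of_sign hkv hcl hsign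
  refine ⟨k, ?_, hmin⟩
  -- Prescribing `a i w = c i` gives a direction pointing strictly inwards at every tight wall.
  obtain ⟨w, hw⟩ := exists_forall_mem_apply_eq hs hspan c
  obtain ⟨ε, -, hm⟩ := exists_add_smul_mem_openCell (w := w) hkv
    (fun i hi => by
      have hit := mem_tightSet_of_eq hi
      rw [hw i hit]
      rcases hsign i (by rwa [← hc] at hit) with h | h
      · exact h.2
      · linarith)
    (fun i hi => by
      have hit := mem_tightSet_of_eq_add_one hi
      rw [hw i hit]
      rcases hsign i (by rwa [← hc] at hit) with h | h
      · linarith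
      · exact h.2)
  exact ⟨_, hm⟩

variable [TopologicalSpace E] [IsTopologicalAddGroup E] [ContinuousSMul ℝ E] [T2Space E]

/-- Spanning normals embed `E` as a closed subspace of `ι → ℝ`, and the cell is the preimage of a
box. -/
theorem isCompact_closedCell [Finite ι] (hspan : Submodule.span ℝ (range a) = ⊤) :
    IsCompact (closedCell a b k) := by
  have := Fintype.ofFinite ι
  have hinj : LinearMap.ker (LinearMap.pi a) = ⊥ := by
    refine (Submodule.eq_bot_iff _).2 fun x hx => ?_
    refine eq_zero_of_forall_apply_eq_zero (s := univ) (by rwa [image_univ]) fun i _ => ?_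
    exact congrFun (LinearMap.mem_ker.1 hx) i
  have hemb := LinearMap.isClosedEmbedding_of_injective hinj
  have : closedCell a b k =
      LinearMap.pi a ⁻¹' (Icc (fun i => b i + k i) (fun i => b i + k i + 1)) := by
    ext x
    simp [closedCell, Pi.le_def, forall_and]
  rw [this]
  exact hemb.isCompact_preimage isCompact_Icc

theorem exists_isCellMin [Finite ι] (hspan : Submodule.span ℝ (range a) = ⊤)
    (hne : (closedCell a b k).Nonempty) : ∃ v, IsCellMin a b ℓ k v := by
  obtain ⟨v, hv, hmin⟩ := (isCompact_closedCell hspan).exists_isMinOn hne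
    (LinearMap.continuous_of_finiteDimensional ℓ).continuousOn
  exact ⟨v, hv, fun x hx => hmin hx⟩

theorem isOpen_openCell [Finite ι] : IsOpen (openCell a b k) := by
  have : openCell a b k = ⋂ i, a i ⁻¹' Ioo (b i + k i) (b i + k i + 1) := by
    ext x; simp [openCell]
  rw [this]
  exact isOpen_iInter_of_finite fun i =>
    isOpen_Ioo.preimage (LinearMap.continuous_of_finiteDimensional (a i))

end PeriodicArrangement

/-! ### Bijections from relations, components from partitions -/

theorem nonempty_equiv_of_existsUnique {α β : Type*} {r : α → β → Prop}
    (h₁ : ∀ x, ∃ y, r x y) (h₂ : ∀ x y y', r x y → r x y' → y = y')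
    (h₃ : ∀ y, ∃ x, r x y) (h₄ : ∀ x x' y, r x y → r x' y → x = x') : Nonempty (α ≃ β) := by
  choose f hf using h₁
  refine ⟨Equiv.ofBijective f ⟨fun x x' h => h₄ x x' (f x) (hf x) (h ▸ hf x'), fun y => ?_⟩⟩
  obtain ⟨x, hx⟩ := h₃ y
  exact ⟨x, h₂ x _ _ (hf x) hx⟩

/-- If a set is partitioned into relatively open preconnected classes, these classes are its
connected components. -/
theorem connectedComponentIn_eq_of_partition {X : Type*} [TopologicalSpace X] {F : Set X}
    {cls : X → Set X} (hself : ∀ p ∈ F, p ∈ cls p) (hsub : ∀ p ∈ F, cls p ⊆ F)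
    (hconn : ∀ p ∈ F, IsPreconnected (cls p))
    (hopen : ∀ p ∈ F, ∃ U, IsOpen U ∧ p ∈ U ∧ U ∩ F ⊆ cls p)
    (heq : ∀ p ∈ F, ∀ q ∈ cls p, cls q = cls p) {p : X} (hp : p ∈ F) :
    connectedComponentIn F p = cls p := by
  refine Subset.antisymm ?_
    ((hconn p hp).subset_connectedComponentIn (hself p hp) (hsub p hp))
  choose! N hN using hopen
  by_contra hnot
  obtain ⟨q, hqC, hq⟩ := not_subset.1 hnot
  have hCF := connectedComponentIn_subset F p
  -- The neighbourhoods of points inside and outside the class cover the component; a common point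
  -- `r` would identify the two classes.
  obtain ⟨r, hrC, h1, h2⟩ := isPreconnected_connectedComponentIn (F := F) (x := p)
    (⋃ q ∈ cls p, N q) (⋃ q ∈ F \ cls p, N q)
    (isOpen_biUnion fun q hq => (hN q (hsub p hp hq)).1)
    (isOpen_biUnion fun q hq => (hN q hq.1).1)
    (fun r hr => by
      by_cases h : r ∈ cls p
      · exact Or.inl (mem_biUnion h (hN r (hCF hr)).2.1)
      · exact Or.inr (mem_biUnion (show r ∈ F \ cls p from ⟨hCF hr, h⟩) (hN r (hCF hr)).2.1))
    ⟨p, mem_connectedComponentIn hp, mem_biUnion (hself p hp) (hN p hp).2.1⟩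
    ⟨q, hqC, mem_biUnion (show q ∈ F \ cls p from ⟨hCF hqC, hq⟩) (hN q (hCF hqC)).2.1⟩
  simp only [mem_iUnion, exists_prop] at h1 h2
  obtain ⟨x, hx, hrx⟩ := h1
  obtain ⟨y, hy, hry⟩ := h2
  have e1 := heq x (hsub p hp hx) r ((hN x (hsub p hp hx)).2.2 ⟨hrx, hCF hrC⟩)
  have e2 := heq y hy.1 r ((hN y hy.1).2.2 ⟨hry, hCF hrC⟩)
  apply hy.2
  rw [← heq p hp x hx, ← e1, e2]
  exact hself y hy.1

theorem eq_zero_of_forall_mul_eq_intCast {x : ℝ} (h : ∀ t : ℝ, ∃ m : ℤ, t * x = m) : x = 0 := by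
  by_contra hx
  obtain ⟨m, hm⟩ := h (1 / (2 * x))
  have h1 : (1 / (2 * x)) * x = 1 / 2 := by field_simp
  rw [h1] at hm
  have h2 : (2 * m : ℤ) = 1 := by exact_mod_cast (by linarith : (2 * m : ℝ) = 1)
  omega

/-! ### The covering ℝⁿ → 𝕋ⁿ and linear lifts of characters -/

section TorusProj

variable {n : ℕ}

theorem torusProj_add (v w : Fin n → ℝ) : torusProj (v + w) = torusProj v + torusProj w := by
  funext i; simp [torusProj]

theorem continuous_torusProj : Continuous (torusProj : (Fin n → ℝ) → Torus n) :=
  continuous_pi fun i => (AddCircle.continuous_mk' 1).comp (continuous_apply i)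

theorem isOpenMap_torusProj : IsOpenMap (torusProj : (Fin n → ℝ) → Torus n) :=
  IsOpenMap.piMap (fun _ => QuotientAddGroup.isOpenMap_coe) (by simp)

theorem torusProj_surjective : Function.Surjective (torusProj : (Fin n → ℝ) → Torus n) := by
  intro p
  choose v hv using fun i => QuotientAddGroup.mk_surjective (p i)
  exact ⟨v, funext hv⟩

theorem UnitAddCircle.coe_eq_coe_iff {x y : ℝ} :
    (x : UnitAddCircle) = y ↔ ∃ m : ℤ, y = x + m := by
  rw [eq_comm, QuotientAddGroup.eq_iff_sub_mem, AddSubgroup.mem_zmultiples_iff]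
  refine exists_congr fun m => ?_
  rw [zsmul_eq_mul, mul_one, eq_sub_iff_add_eq, eq_comm, add_comm]

/-- A continuous homomorphism from the torus to the circle lifts to a linear functional. -/
theorem exists_dual_lift (θ : Torus n →ₜ+ UnitAddCircle) :
    ∃ a : Dual ℝ (Fin n → ℝ), ∀ v, ((a v : ℝ) : UnitAddCircle) = θ (torusProj v) := by
  have h0 : torusProj (0 : Fin n → ℝ) = 0 := by funext i; simp [torusProj]
  obtain ⟨F, ⟨hF0, hF⟩, -⟩ := (AddCircle.isCoveringMap_coe (1 : ℝ)).existsUnique_continuousMap_lifts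
    ⟨fun v : Fin n → ℝ => θ (torusProj v), θ.continuous_toFun.comp continuous_torusProj⟩
    0 0 (by simp [h0])
  have hF' : ∀ v, ((F v : ℝ) : UnitAddCircle) = θ (torusProj v) := fun v => congrFun hF v
  have hadd : ∀ v w, F (v + w) = F v + F w := by
    intro v w
    -- The additivity defect along `t • w` is continuous and integer-valued, hence constant, and it
    -- is zero at `t = 0`.
    have hint : ∀ t : ℝ, ∃ m : ℤ, F (v + t • w) - F v - F (t • w) = m := by
      intro t
      have : ((F v + F (t • w) : ℝ) : UnitAddCircle) = (F (v + t • w) : ℝ) := by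
        rw [AddCircle.coe_add, hF', hF', hF', torusProj_add, map_add]
      obtain ⟨m, hm⟩ := UnitAddCircle.coe_eq_coe_iff.1 this
      exact ⟨m, by rw [hm]; ring⟩
    choose m hm using hint
    have hc : Continuous m := by
      rw [Int.isClosedEmbedding_coe_real.isInducing.continuous_iff]
      have : ((↑) : ℤ → ℝ) ∘ m = fun t : ℝ => F (v + t • w) - F v - F (t • w) :=
        funext fun t => (hm t).symm
      rw [this]
      fun_prop
    have h10 : m 1 = m 0 := (PreconnectedSpace.constant inferInstance hc)
    have h1 := hm 1
    have h2 := hm 0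
    rw [h10, ← h2] at h1
    simp [hF0] at h1
    linarith
  let G : (Fin n → ℝ) →+ ℝ := ⟨⟨F, hF0⟩, hadd⟩
  exact ⟨(G.toRealLinearMap F.continuous).toLinearMap, hF'⟩

theorem IsToricHyperplane.isClosed {H : Set (Torus n)} (h : IsToricHyperplane H) :
    IsClosed H := by
  obtain ⟨θ, b, -, rfl⟩ := h
  exact isClosed_singleton.preimage θ.continuous_toFun

theorem IsToricHyperplane.exists_dual {H : Set (Torus n)} (h : IsToricHyperplane H) :
    ∃ (a : Dual ℝ (Fin n → ℝ)) (b : ℝ),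
      (∀ v w, torusProj v = torusProj w → ∃ m : ℤ, a w = a v + m) ∧
      ∀ v, torusProj v ∈ H ↔ ∃ m : ℤ, a v = b + m := by
  obtain ⟨θ, b, -, rfl⟩ := h
  obtain ⟨a, ha⟩ := exists_dual_lift θ
  obtain ⟨b, rfl⟩ := QuotientAddGroup.mk_surjective b
  refine ⟨a, b, fun v w hvw => ?_, fun v => ?_⟩
  · rw [← UnitAddCircle.coe_eq_coe_iff, ha, ha, hvw]
  · rw [← UnitAddCircle.coe_eq_coe_iff, ha, mem_preimage, mem_singleton_iff, eq_comm]

end TorusProj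

/-! ### Components of intersections, and finiteness of the poset -/

namespace ToricArrangement

variable {n : ℕ} {A : ToricArrangement n}

/-- Affine equations for the preimages in `ℝⁿ` of the hyperplanes of a toric arrangement. -/
structure Equations (A : ToricArrangement n) where
  normal : A.hyperplanes → Dual ℝ (Fin n → ℝ)
  offset : A.hyperplanes → ℝ
  normal_eq_add_int : ∀ i v w, torusProj v = torusProj w → ∃ m : ℤ, normal i w = normal i v + m
  mem_iff : ∀ (i : A.hyperplanes) v, torusProj v ∈ i.1 ↔ i ∈ tightSet normal offset v

theorem nonempty_equations (A : ToricArrangement n) : Nonempty A.Equations := by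
  choose a b h₁ h₂ using fun i : A.hyperplanes => (A.isToricHyperplane i.1 i.2).exists_dual
  exact ⟨⟨a, b, h₁, h₂⟩⟩

/-- The intersection of a family of hyperplanes of the arrangement. -/
def inter (s : Finset A.hyperplanes) : Set (Torus n) := {p | ∀ i ∈ s, p ∈ i.1}

theorem biInter_map (s : Finset A.hyperplanes) :
    ⋂ H ∈ s.map (Function.Embedding.subtype _), H = inter s := by
  ext p; simp [inter]

theorem exists_map_eq {S : Finset (Set (Torus n))} (hS : S ⊆ A.hyperplanes) :
    ∃ s : Finset A.hyperplanes, s.map (Function.Embedding.subtype _) = S := by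
  classical
  exact ⟨S.subtype (· ∈ A.hyperplanes), Finset.subtype_map_of_mem fun H hH => hS hH⟩

theorem map_subset (s : Finset A.hyperplanes) :
    s.map (Function.Embedding.subtype _) ⊆ A.hyperplanes := by
  intro H hH
  simp only [Finset.mem_map] at hH
  obtain ⟨i, -, rfl⟩ := hH
  exact i.2

theorem isClosed_inter (s : Finset A.hyperplanes) : IsClosed (inter s) := by
  rw [← biInter_map]
  exact isClosed_biInter fun H hH => (A.isToricHyperplane H (map_subset s hH)).isClosed

namespace Equations

variable (D : A.Equations)

/-- The common kernel of a family of normals. -/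
def ker (s : Finset A.hyperplanes) : Submodule ℝ (Fin n → ℝ) :=
  ⨅ i : s, LinearMap.ker (D.normal i)

theorem mem_ker {s : Finset A.hyperplanes} {w : Fin n → ℝ} :
    w ∈ D.ker s ↔ ∀ i ∈ s, D.normal i w = 0 := by
  simp [ker]

theorem torusProj_mem_inter {s : Finset A.hyperplanes} {v : Fin n → ℝ} :
    torusProj v ∈ inter s ↔ ∀ i ∈ s, i ∈ tightSet D.normal D.offset v :=
  forall₂_congr fun i _ => D.mem_iff i v

/-- The projection of the affine subspace through `v` along the common kernel of a family of
normals. -/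
def component (s : Finset A.hyperplanes) (v : Fin n → ℝ) : Set (Torus n) :=
  (fun w => torusProj (v + w)) '' (D.ker s : Set (Fin n → ℝ))

theorem torusProj_add_mem_inter {s : Finset A.hyperplanes} {v w : Fin n → ℝ}
    (hv : torusProj v ∈ inter s) (hw : w ∈ D.ker s) : torusProj (v + w) ∈ inter s := by
  rw [D.torusProj_mem_inter] at hv ⊢
  intro i hi
  obtain ⟨m, hm⟩ := hv i hi
  exact ⟨m, by rw [map_add, D.mem_ker.1 hw i hi, add_zero, hm]⟩

/-- Along the line each normal changes by integers only, so its slope is zero. -/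
theorem mem_ker_of_forall {s : Finset A.hyperplanes} {v w : Fin n → ℝ}
    (h : ∀ t : ℝ, torusProj (v + t • w) ∈ inter s) : w ∈ D.ker s := by
  refine D.mem_ker.2 fun i hi => eq_zero_of_forall_mul_eq_intCast fun t => ?_
  obtain ⟨m, hm⟩ := D.torusProj_mem_inter.1 (h t) i hi
  obtain ⟨m₀, hm₀⟩ := D.torusProj_mem_inter.1 (h 0) i hi
  refine ⟨m - m₀, ?_⟩
  simp only [map_add, map_smul, smul_eq_mul, zero_mul, add_zero] at hm hm₀
  push_cast
  linarith

theorem tangentDirections_inter {s : Finset A.hyperplanes} (hne : (inter s).Nonempty) :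
    tangentDirections (inter s) = D.ker s := by
  ext w
  constructor
  · intro hw
    obtain ⟨p, hp⟩ := hne
    obtain ⟨v, rfl⟩ := torusProj_surjective p
    refine D.mem_ker_of_forall (v := v) fun t => ?_
    rw [torusProj_add]
    exact hw _ hp t
  · intro hw p hp t
    obtain ⟨v, rfl⟩ := torusProj_surjective p
    rw [← torusProj_add]
    exact D.torusProj_add_mem_inter hp (Submodule.smul_mem _ t hw)

theorem torusProj_mem_component (s : Finset A.hyperplanes) (v : Fin n → ℝ) :
    torusProj v ∈ D.component s v := ⟨0, zero_mem _, by simp⟩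

theorem component_subset_inter {s : Finset A.hyperplanes} {v : Fin n → ℝ}
    (hv : torusProj v ∈ inter s) : D.component s v ⊆ inter s := by
  rintro _ ⟨w, hw, rfl⟩
  exact D.torusProj_add_mem_inter hv hw

theorem tangentDirections_component {s : Finset A.hyperplanes} {v : Fin n → ℝ}
    (hv : torusProj v ∈ inter s) : tangentDirections (D.component s v) = D.ker s := by
  ext w
  constructor
  · intro hw
    refine D.mem_ker_of_forall (v := v) fun t => ?_
    rw [torusProj_add]
    exact D.component_subset_inter hv (hw _ (D.torusProj_mem_component s v) t)
  · rintro hw _ ⟨u, hu, rfl⟩ t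
    exact ⟨u + t • w, add_mem hu (Submodule.smul_mem _ t hw), by
      simp only [← add_assoc, torusProj_add]⟩

theorem isPreconnected_component (s : Finset A.hyperplanes) (v : Fin n → ℝ) :
    IsPreconnected (D.component s v) :=
  (D.ker s).convex.isPreconnected.image _
    (continuous_torusProj.comp (continuous_const.add continuous_id)).continuousOn

theorem component_eq_of_mem {s : Finset A.hyperplanes} {v v' : Fin n → ℝ}
    (h : torusProj v' ∈ D.component s v) : D.component s v' = D.component s v := by
  obtain ⟨w, hw, hvw⟩ := h
  simp only at hvw
  ext q
  constructor
  · rintro ⟨u, hu, rfl⟩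
    exact ⟨w + u, add_mem hw hu, by simp only [← add_assoc, torusProj_add (v + w), hvw, torusProj_add v']⟩
  · rintro ⟨u, hu, rfl⟩
    refine ⟨u - w, sub_mem hu hw, ?_⟩
    simp only
    rw [torusProj_add, ← hvw, ← torusProj_add]
    congr 1
    abel

theorem exists_nhds_subset_component {s : Finset A.hyperplanes} {v : Fin n → ℝ}
    (hv : torusProj v ∈ inter s) :
    ∃ U, IsOpen U ∧ torusProj v ∈ U ∧ U ∩ inter s ⊆ D.component s v := by
  -- Radius 1 suffices: on the intersection the values of each normal differ by integers.
  let B : Set (Fin n → ℝ) := ⋂ i : s, {w | |D.normal i w - D.normal i v| < 1}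
  have hB : IsOpen B := isOpen_iInter_of_finite fun i => by
    have := LinearMap.continuous_of_finiteDimensional (D.normal i)
    exact isOpen_lt (by fun_prop) continuous_const
  refine ⟨torusProj '' B, isOpenMap_torusProj _ hB, ⟨v, by simp [B], rfl⟩, ?_⟩
  rintro _ ⟨⟨w, hw, rfl⟩, hws⟩
  refine ⟨w - v, D.mem_ker.2 fun i hi => ?_, by simp⟩
  obtain ⟨m, hm⟩ := D.torusProj_mem_inter.1 hv i hi
  obtain ⟨m', hm'⟩ := D.torusProj_mem_inter.1 hws i hi
  have h1 : |D.normal i w - D.normal i v| < 1 := by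
    have := mem_iInter.1 hw ⟨i, hi⟩
    exact this
  have h2 : D.normal i w - D.normal i v = ((m' - m : ℤ) : ℝ) := by
    rw [hm, hm']; push_cast; ring
  rw [map_sub, h2]
  rw [h2] at h1
  have h3 : |m' - m| < 1 := by exact_mod_cast h1
  rw [Int.abs_lt_one_iff.1 h3, Int.cast_zero]

theorem connectedComponentIn_inter {s : Finset A.hyperplanes} {v : Fin n → ℝ}
    (hv : torusProj v ∈ inter s) :
    connectedComponentIn (inter s) (torusProj v) = D.component s v := by
  -- Lifts are chosen only to index classes by points of the torus; `component_eq_of_mem` makes the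
  -- choice immaterial.
  let σ : Torus n → (Fin n → ℝ) := Function.surjInv torusProj_surjective
  have hσ : ∀ p, torusProj (σ p) = p := Function.surjInv_eq torusProj_surjective
  rw [connectedComponentIn_eq_of_partition (cls := fun p => D.component s (σ p)) _ _ _ _ _ hv]
  · refine (D.component_eq_of_mem ?_).symm
    have := D.torusProj_mem_component s (σ (torusProj v))
    rwa [hσ] at this
  · intro p _
    have := D.torusProj_mem_component s (σ p)
    rwa [hσ] at this
  · exact fun p hp => D.component_subset_inter (by rwa [hσ])
  · exact fun p _ => D.isPreconnected_component s _
  · intro p hp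
    have := D.exists_nhds_subset_component (s := s) (v := σ p) (by rwa [hσ])
    rwa [hσ] at this
  · exact fun p hp q hq => D.component_eq_of_mem (by rwa [hσ])

end Equations

/-- The intersection is compact and its components are relatively open. -/
theorem finite_setOf_connectedComponentIn (s : Finset A.hyperplanes) :
    {X | ∃ p ∈ inter s, X = connectedComponentIn (inter s) p}.Finite := by
  obtain ⟨D⟩ := A.nonempty_equations
  have hN : ∀ p ∈ inter s, ∃ U, IsOpen U ∧ p ∈ U ∧
      U ∩ inter s ⊆ connectedComponentIn (inter s) p := by
    intro p hp
    obtain ⟨v, rfl⟩ := torusProj_surjective p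
    rw [D.connectedComponentIn_inter hp]
    exact D.exists_nhds_subset_component hp
  choose! N hN using hN
  obtain ⟨t, ht, hcov⟩ := (isClosed_inter s).isCompact.elim_nhds_subcover N
    fun p hp => (hN p hp).1.mem_nhds (hN p hp).2.1
  refine (t.finite_toSet.image fun p => connectedComponentIn (inter s) p).subset ?_
  rintro _ ⟨q, hq, rfl⟩
  obtain ⟨p, hp, hqp⟩ := mem_iUnion₂.1 (hcov hq)
  exact ⟨p, hp, (connectedComponentIn_eq ((hN p (ht p hp)).2.2 ⟨hqp, hq⟩))⟩

theorem finite_intersectionPoset (A : ToricArrangement n) : Finite A.IntersectionPoset := by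
  have h := Set.finite_iUnion fun s : Finset A.hyperplanes => finite_setOf_connectedComponentIn s
  refine (h.subset ?_).to_subtype
  rintro X ⟨S, hS, p, hp, rfl⟩
  obtain ⟨s, rfl⟩ := exists_map_eq hS
  rw [biInter_map] at hp ⊢
  exact mem_iUnion.2 ⟨s, p, hp, rfl⟩

/-! ### General position as linear independence of normals -/

namespace Equations

variable (D : A.Equations)

theorem mem_span_of_ker_le {s : Finset A.hyperplanes} {i : A.hyperplanes}
    (h : ∀ w ∈ D.ker s, D.normal i w = 0) :
    D.normal i ∈ Submodule.span ℝ (D.normal '' (s : Set A.hyperplanes)) := by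
  rw [Set.image_eq_range]
  exact mem_span_of_iInf_ker_le_ker (L := fun j : s => D.normal j) fun w hw => h w hw

theorem ker_eq_dualCoannihilator (s : Finset A.hyperplanes) :
    D.ker s = (Submodule.span ℝ (D.normal '' (s : Set A.hyperplanes))).dualCoannihilator := by
  ext w
  rw [D.mem_ker, Submodule.mem_dualCoannihilator]
  refine ⟨fun h φ hφ => ?_, fun h i hi => h _ (Submodule.subset_span ⟨i, hi, rfl⟩)⟩
  induction hφ using Submodule.span_induction with
  | mem y hy => obtain ⟨i, hi, rfl⟩ := hy; exact h i hi
  | zero => simp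
  | add y z _ _ hy hz => simp [hy, hz]
  | smul c y _ hy => simp [hy]

theorem finrank_ker_add (s : Finset A.hyperplanes) :
    finrank ℝ (Submodule.span ℝ (D.normal '' (s : Set A.hyperplanes))) +
      finrank ℝ (D.ker s) = n := by
  rw [ker_eq_dualCoannihilator, Subspace.finrank_add_finrank_dualCoannihilator_eq,
    Module.finrank_fin_fun]

/-- General position bounds the common kernel by `n - s.card`, so by rank-nullity the span has
dimension at least `s.card`. -/
theorem linearIndepOn_of_nonempty (hgen : A.IsGeneralPosition) {s : Finset A.hyperplanes}
    (hne : (inter s).Nonempty) : LinearIndepOn ℝ D.normal (s : Set A.hyperplanes) := by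
  obtain ⟨h1, h2⟩ := hgen _ (map_subset s)
  rw [biInter_map, Finset.card_map] at h1 h2
  have hcard : s.card ≤ n := by
    by_contra h
    exact hne.ne_empty (h2 (not_le.1 h))
  have h3 := h1 hcard hne
  rw [torusDim, D.tangentDirections_inter hne] at h3
  have h4 := D.finrank_ker_add s
  rw [LinearIndepOn, linearIndependent_iff_card_le_finrank_span, Set.finrank,
    ← Set.image_eq_range]
  simp only [Finset.coe_sort_coe, Fintype.card_coe]
  omega

/-- The finite set of hyperplanes of the arrangement passing through the projection of `v`. -/
noncomputable def tight (v : Fin n → ℝ) : Finset A.hyperplanes :=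
  (Set.toFinite (tightSet D.normal D.offset v)).toFinset

theorem coe_tight (v : Fin n → ℝ) : (D.tight v : Set A.hyperplanes) = tightSet D.normal D.offset v :=
  Set.Finite.coe_toFinset _

theorem torusProj_mem_inter_iff {s : Finset A.hyperplanes} {v : Fin n → ℝ} :
    torusProj v ∈ inter s ↔ s ⊆ D.tight v := by
  rw [D.torusProj_mem_inter, ← Finset.coe_subset, coe_tight]
  rfl

theorem linearIndepOn_tightSet (hgen : A.IsGeneralPosition) (v : Fin n → ℝ) :
    LinearIndepOn ℝ D.normal (tightSet D.normal D.offset v) := by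
  rw [← D.coe_tight]
  exact D.linearIndepOn_of_nonempty hgen ⟨_, D.torusProj_mem_inter_iff.2 subset_rfl⟩

theorem span_range_normal (hgen : A.IsGeneralPosition) (hspan : A.IsSpanning) :
    Submodule.span ℝ (range D.normal) = ⊤ := by
  obtain ⟨S, hS, hcard, hne⟩ := hspan
  obtain ⟨s, rfl⟩ := exists_map_eq hS
  rw [biInter_map] at hne
  rw [Finset.card_map] at hcard
  have hli := D.linearIndepOn_of_nonempty hgen hne
  have h := LinearIndependent.span_eq_top_of_card_eq_finrank' hli
    (by simp [Subspace.dual_finrank_eq, hcard])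
  rw [eq_top_iff, ← h]
  refine Submodule.span_mono ?_
  rintro _ ⟨i, rfl⟩
  exact ⟨i, rfl⟩

end Equations

end ToricArrangement

namespace ToricArrangement

variable {n : ℕ} {A : ToricArrangement n}

namespace Equations

variable (D : A.Equations)

/-! ### The Möbius function on Boolean intervals -/

section Moebius

/-- The component through the projection of `v` of the intersection of a family of hyperplanes. -/
def flat (s : Finset A.hyperplanes) (v : Fin n → ℝ) (hv : torusProj v ∈ inter s) :
    A.IntersectionPoset :=
  ⟨D.component s v, s.map (Function.Embedding.subtype _), map_subset s, torusProj v, by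
    rwa [biInter_map], by rw [biInter_map, D.connectedComponentIn_inter hv]⟩

theorem exists_eq_flat (X : A.IntersectionPoset) :
    ∃ s v, ∃ hv : torusProj v ∈ inter s, X = D.flat s v hv := by
  obtain ⟨X, S, hS, p, hp, rfl⟩ := X
  obtain ⟨s, rfl⟩ := exists_map_eq hS
  obtain ⟨v, rfl⟩ := torusProj_surjective p
  have hv := hp
  rw [biInter_map] at hv
  refine ⟨s, v, hv, Subtype.ext ?_⟩
  change connectedComponentIn _ _ = D.component s v
  rw [biInter_map, D.connectedComponentIn_inter hv]

/-- Lets all flats below a given one be based at the same lift `v`, so that they are compared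
through their index sets. -/
theorem exists_eq_flat_of_mem {X : A.IntersectionPoset} {v : Fin n → ℝ} (h : torusProj v ∈ X.1) :
    ∃ s, ∃ hv : torusProj v ∈ inter s, X = D.flat s v hv := by
  obtain ⟨s, w, hw, rfl⟩ := D.exists_eq_flat X
  exact ⟨s, D.component_subset_inter hw h, Subtype.ext (D.component_eq_of_mem h).symm⟩

/-- If `i ∈ s` were missing from `s'`, its normal would vanish on `ker s'` and so lie in the span of
other tight normals, against independence. -/
theorem component_subset_component_iff (hgen : A.IsGeneralPosition)
    {s s' : Finset A.hyperplanes} {v : Fin n → ℝ} (hs : s ⊆ D.tight v) (hs' : s' ⊆ D.tight v) :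
    D.component s' v ⊆ D.component s v ↔ s ⊆ s' := by
  constructor
  · intro h i hi
    by_contra hi'
    have hv := D.torusProj_mem_inter_iff.2 hs
    have hker : ∀ w ∈ D.ker s', D.normal i w = 0 := fun w hw => by
      refine D.mem_ker.1 (D.mem_ker_of_forall (s := s) (v := v) fun t => ?_) i hi
      exact D.component_subset_inter hv (h ⟨t • w, Submodule.smul_mem _ t hw, rfl⟩)
    have hit : i ∈ tightSet D.normal D.offset v := by
      rw [← D.coe_tight]; exact hs hi
    refine LinearIndepOn.notMem_span (D.linearIndepOn_tightSet hgen v) hit ?_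
    refine Submodule.span_mono (image_mono fun j hj => ?_) (D.mem_span_of_ker_le hker)
    refine ⟨?_, fun e => hi' ((mem_singleton_iff.1 e) ▸ hj)⟩
    rw [← D.coe_tight]; exact hs' hj
  · rintro h _ ⟨w, hw, rfl⟩
    exact ⟨w, D.mem_ker.2 fun i hi => D.mem_ker.1 hw i (h hi), rfl⟩

/-- The interval below the flat is the lattice of subsets of `s`; the recursion for μ then matches
the vanishing of the alternating sum over a nonempty powerset. -/
theorem moebius_flat (hgen : A.IsGeneralPosition) {s : Finset A.hyperplanes} {v : Fin n → ℝ}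
    (hv : torusProj v ∈ inter s) :
    (D.flat s v hv).moebius = (-1) ^ s.card := by
  classical
  induction s using Finset.strongInduction with
  | H s ih =>
  have hst := D.torusProj_mem_inter_iff.1 hv
  have hmono : ∀ s' ⊆ s, torusProj v ∈ inter s' := fun s' h =>
    D.torusProj_mem_inter_iff.2 (h.trans hst)
  have hle : ∀ s₁ s₂ (h₁ : s₁ ⊆ s) (h₂ : s₂ ⊆ s),
      D.flat s₁ v (hmono _ h₁) ≤ D.flat s₂ v (hmono _ h₂) ↔ s₁ ⊆ s₂ := fun s₁ s₂ h₁ h₂ =>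
    D.component_subset_component_iff hgen (h₁.trans hst) (h₂.trans hst)
  have hbot : ⊥ = D.flat ∅ v (hmono _ (Finset.empty_subset _)) := by
    obtain ⟨s', hv', h⟩ := D.exists_eq_flat_of_mem (X := ⊥) (v := v) (Set.mem_univ _)
    refine le_antisymm bot_le ?_
    rw [h]
    exact (D.component_subset_component_iff hgen (Finset.empty_subset _)
      (D.torusProj_mem_inter_iff.1 hv')).2 (Finset.empty_subset _)
  unfold IntersectionPoset.moebius
  by_cases hs : s = ∅
  · subst hs
    rw [← hbot, IncidenceAlgebra.mu_self]; simp
  have hne : ⊥ ≠ D.flat s v hv := by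
    rw [hbot]
    intro e
    exact hs (Finset.subset_empty.1 ((hle s ∅ subset_rfl (Finset.empty_subset _)).1 e.ge))
  rw [IncidenceAlgebra.mu_eq_neg_sum_Ico_of_ne hne]
  have hsum : ∑ X ∈ Finset.Ico ⊥ (D.flat s v hv), IncidenceAlgebra.mu ℤ ⊥ X =
      ∑ s' ∈ s.ssubsets, (-1 : ℤ) ^ s'.card := by
    symm
    refine Finset.sum_bij
      (fun s' hs' => D.flat s' v (hmono s' (Finset.mem_ssubsets.1 hs').1)) ?_ ?_ ?_ ?_
    · intro s' hs'
      have h := Finset.mem_ssubsets.1 hs'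
      refine Finset.mem_Ico.2 ⟨bot_le, lt_of_le_not_ge ((hle s' s h.1 subset_rfl).2 h.1) ?_⟩
      exact fun h' => h.2 ((hle s s' subset_rfl h.1).1 h')
    · intro s₁ h₁ s₂ h₂ e
      have h₁' := (Finset.mem_ssubsets.1 h₁).1
      have h₂' := (Finset.mem_ssubsets.1 h₂).1
      exact Finset.Subset.antisymm ((hle s₁ s₂ h₁' h₂').1 e.le) ((hle s₂ s₁ h₂' h₁').1 e.ge)
    · intro X hX
      have hXlt := (Finset.mem_Ico.1 hX).2
      obtain ⟨s', hv', rfl⟩ := D.exists_eq_flat_of_mem (hXlt.le (D.torusProj_mem_component s v))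
      have hs' := D.torusProj_mem_inter_iff.1 hv'
      refine ⟨s', Finset.mem_ssubsets.2 ⟨?_, fun h => hXlt.not_ge ?_⟩, rfl⟩
      · exact (D.component_subset_component_iff hgen hs' hst).1 hXlt.le
      · exact (D.component_subset_component_iff hgen hst hs').2 h
    · intro s' hs'
      exact (ih s' (Finset.mem_ssubsets.1 hs') _).symm
  rw [hsum]
  have htot := Finset.sum_powerset_neg_one_pow_card_of_nonempty (Finset.nonempty_iff_ne_empty.2 hs)
  rw [← Finset.add_sum_erase _ _ (Finset.mem_powerset_self s)] at htot
  change _ + ∑ s' ∈ s.ssubsets, (-1 : ℤ) ^ s'.card = 0 at htot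
  linarith

end Moebius

/-! ### Vertices and the characteristic polynomial at zero -/

/-- A vertex is a point at which the normals of the hyperplanes through it span. -/
def vertices : Set (Torus n) :=
  {p | ∃ v, torusProj v = p ∧
    Submodule.span ℝ (D.normal '' tightSet D.normal D.offset v) = ⊤}

theorem ker_eq_bot_iff (s : Finset A.hyperplanes) :
    D.ker s = ⊥ ↔ Submodule.span ℝ (D.normal '' (s : Set A.hyperplanes)) = ⊤ := by
  have h := D.finrank_ker_add s
  constructor
  · intro hk
    rw [hk, finrank_bot, add_zero] at h
    exact Submodule.eq_top_of_finrank_eq (by rw [h, Subspace.dual_finrank_eq, finrank_fin_fun])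
  · intro hs
    rw [hs, finrank_top, Subspace.dual_finrank_eq, finrank_fin_fun] at h
    exact Submodule.finrank_eq_zero.1 (by omega)

theorem component_of_ker_eq_bot {s : Finset A.hyperplanes} (h : D.ker s = ⊥) (v : Fin n → ℝ) :
    D.component s v = {torusProj v} := by
  simp [component, h]

theorem torusDim_flat {s : Finset A.hyperplanes} {v : Fin n → ℝ} (hv : torusProj v ∈ inter s) :
    torusDim (D.flat s v hv).1 = finrank ℝ (D.ker s) := by
  change finrank ℝ (tangentDirections (D.component s v)) = _
  rw [D.tangentDirections_component hv]

theorem moebius_eq_of_torusDim_eq_zero (hgen : A.IsGeneralPosition) {X : A.IntersectionPoset}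
    (hX : torusDim X.1 = 0) : X.moebius = (-1) ^ n := by
  obtain ⟨D⟩ := A.nonempty_equations
  obtain ⟨s, v, hv, rfl⟩ := D.exists_eq_flat X
  rw [D.torusDim_flat] at hX
  rw [D.moebius_flat hgen]
  have h := D.finrank_ker_add s
  have hli := D.linearIndepOn_of_nonempty hgen ⟨_, hv⟩
  have hc := finrank_span_eq_card hli
  rw [← Set.image_eq_range] at hc
  simp only [Finset.coe_sort_coe, Fintype.card_coe] at hc
  congr 1
  omega

/-- A flat of dimension zero has trivial kernel, hence is a single point. -/
theorem nonempty_vertices_equiv :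
    Nonempty (D.vertices ≃ {X : A.IntersectionPoset // torusDim X.1 = 0}) := by
  refine nonempty_equiv_of_existsUnique (r := fun p X => X.1.1 = {p.1}) ?_ ?_ ?_ ?_
  · rintro ⟨_, v, rfl, hv⟩
    rw [← D.coe_tight, ← D.ker_eq_bot_iff] at hv
    refine ⟨⟨D.flat (D.tight v) v (D.torusProj_mem_inter_iff.2 subset_rfl), ?_⟩, ?_⟩
    · rw [D.torusDim_flat, hv, finrank_bot]
    · exact D.component_of_ker_eq_bot hv v
  · intro p X X' h h'
    exact Subtype.ext (Subtype.ext (h.trans h'.symm))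
  · rintro ⟨X, hX⟩
    obtain ⟨s, v, hv, rfl⟩ := D.exists_eq_flat X
    rw [D.torusDim_flat, Submodule.finrank_eq_zero] at hX
    refine ⟨⟨torusProj v, v, rfl, ?_⟩, D.component_of_ker_eq_bot hX v⟩
    rw [D.ker_eq_bot_iff] at hX
    rw [eq_top_iff, ← hX, ← D.coe_tight]
    exact Submodule.span_mono (image_mono (D.torusProj_mem_inter_iff.1 hv))
  · intro p p' X h h'
    exact Subtype.ext (singleton_injective (h.symm.trans h'))

theorem neg_one_pow_mul_eval_charPoly (hgen : A.IsGeneralPosition) :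
    (-1) ^ n * A.charPoly.eval 0 = (Nat.card D.vertices : ℤ) := by
  classical
  have := A.finite_intersectionPoset
  have := Fintype.ofFinite A.IntersectionPoset
  rw [Nat.card_congr D.nonempty_vertices_equiv.some, Nat.card_eq_fintype_card,
    Fintype.card_subtype, charPoly, finsum_eq_sum_of_fintype, Polynomial.eval_finsetSum]
  have h : ∀ X : A.IntersectionPoset,
      (Polynomial.C X.moebius * Polynomial.X ^ torusDim X.1).eval 0 =
        if torusDim X.1 = 0 then (-1) ^ n else 0 := by
    intro X
    by_cases hX : torusDim X.1 = 0
    · simp [hX, moebius_eq_of_torusDim_eq_zero hgen hX]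
    · simp [hX]
  rw [Finset.sum_congr rfl fun X _ => h X, ← Finset.sum_filter, Finset.sum_const, nsmul_eq_mul,
    mul_left_comm, ← mul_pow]
  simp

/-! ### Regions as projected cells, matched with vertices -/

section Regions

theorem exists_label_shift {v w : Fin n → ℝ} (h : torusProj v = torusProj w) :
    ∃ m : A.hyperplanes → ℤ, ∀ i, D.normal i (w - v) = m i := by
  choose m hm using fun i => D.normal_eq_add_int i v w h
  exact ⟨m, fun i => by rw [map_sub, hm i]; ring⟩

variable {D}

theorem add_mem_openCell {k m : A.hyperplanes → ℤ} {x z : Fin n → ℝ}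
    (hz : ∀ i, D.normal i z = m i) (hx : x ∈ openCell D.normal D.offset k) :
    x + z ∈ openCell D.normal D.offset (k + m) := by
  intro i
  have := hx i
  rw [map_add, hz i, Pi.add_apply]
  push_cast
  constructor <;> linarith

theorem add_mem_closedCell {k m : A.hyperplanes → ℤ} {x z : Fin n → ℝ}
    (hz : ∀ i, D.normal i z = m i) (hx : x ∈ closedCell D.normal D.offset k) :
    x + z ∈ closedCell D.normal D.offset (k + m) := by
  intro i
  have := hx i
  rw [map_add, hz i, Pi.add_apply]
  push_cast
  constructor <;> linarith

/-- Translation by `z` changes ℓ by the constant `ℓ z`. -/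
theorem isCellMin_add {ℓ : Dual ℝ (Fin n → ℝ)} {k m : A.hyperplanes → ℤ} {x z : Fin n → ℝ}
    (hz : ∀ i, D.normal i z = m i) (hx : IsCellMin D.normal D.offset ℓ k x) :
    IsCellMin D.normal D.offset ℓ (k + m) (x + z) := by
  refine ⟨add_mem_closedCell hz hx.1, fun y hy => ?_⟩
  have h := add_mem_closedCell (m := -m) (z := -z) (by simp [hz]) hy
  rw [add_neg_cancel_right] at h
  have := hx.2 _ h
  rw [map_add, map_neg] at this
  rw [map_add]
  linarith

theorem torusProj_mem_compl_iff {v : Fin n → ℝ} :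
    torusProj v ∈ (⋃ H ∈ A.hyperplanes, H)ᶜ ↔ tightSet D.normal D.offset v = ∅ := by
  rw [Set.eq_empty_iff_forall_notMem]
  simp only [mem_compl_iff, mem_iUnion, exists_prop, not_exists, not_and]
  exact ⟨fun h i hi => h i.1 i.2 ((D.mem_iff i v).2 hi),
    fun h H hH hv => h ⟨H, hH⟩ ((D.mem_iff ⟨H, hH⟩ v).1 hv)⟩

/-- Points lying in a common lifted cell. -/
def sameCell (D : A.Equations) (p : Torus n) : Set (Torus n) :=
  {q | ∃ v w k, torusProj v = p ∧ torusProj w = q ∧ v ∈ openCell D.normal D.offset k ∧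
    w ∈ openCell D.normal D.offset k}

theorem sameCell_eq {v : Fin n → ℝ} {k : A.hyperplanes → ℤ}
    (hv : v ∈ openCell D.normal D.offset k) :
    D.sameCell (torusProj v) = torusProj '' openCell D.normal D.offset k := by
  ext q
  constructor
  · rintro ⟨v', w, k', hv', rfl, hvk, hwk⟩
    obtain ⟨m, hm⟩ := D.exists_label_shift hv'
    have h1 := add_mem_openCell hm hvk
    rw [add_sub_cancel] at h1
    have h2 := add_mem_openCell hm hwk
    rw [← label_eq_of_mem_openCell hv h1] at h2
    refine ⟨_, h2, ?_⟩
    rw [← add_sub_assoc, add_comm, add_sub_assoc, torusProj_add, ← hv', ← torusProj_add,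
      add_sub_cancel]
  · rintro ⟨w, hw, rfl⟩
    exact ⟨v, w, k, rfl, rfl, hv, hw⟩

theorem connectedComponentIn_compl {v : Fin n → ℝ} {k : A.hyperplanes → ℤ}
    (hv : v ∈ openCell D.normal D.offset k) :
    connectedComponentIn (⋃ H ∈ A.hyperplanes, H)ᶜ (torusProj v) =
      torusProj '' openCell D.normal D.offset k := by
  have hlift : ∀ p ∈ (⋃ H ∈ A.hyperplanes, H)ᶜ,
      ∃ v k, torusProj v = p ∧ v ∈ openCell D.normal D.offset k := by
    intro p hp
    obtain ⟨v, rfl⟩ := torusProj_surjective p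
    exact ⟨v, _, rfl, mem_openCell_floor (D.torusProj_mem_compl_iff.1 hp)⟩
  rw [← sameCell_eq hv]
  refine connectedComponentIn_eq_of_partition (cls := D.sameCell) ?_ ?_ ?_ ?_ ?_
    (D.torusProj_mem_compl_iff.2 (tightSet_eq_empty_of_mem_openCell hv)) <;>
    intro p hp <;> obtain ⟨v, k, rfl, hv⟩ := hlift p hp <;> rw [sameCell_eq hv]
  · exact ⟨v, hv, rfl⟩
  · rintro _ ⟨w, hw, rfl⟩
    exact D.torusProj_mem_compl_iff.2 (tightSet_eq_empty_of_mem_openCell hw)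
  · exact convex_openCell.isPreconnected.image _ continuous_torusProj.continuousOn
  · exact ⟨_, isOpenMap_torusProj _ isOpen_openCell, ⟨v, hv, rfl⟩, inter_subset_left⟩
  · rintro _ ⟨w, hw, rfl⟩
    exact sameCell_eq hw

theorem exists_lift (D : A.Equations) (u : ↥((⋃ H ∈ A.hyperplanes, H)ᶜ : Set (Torus n))) :
    ∃ v k, torusProj v = u.1 ∧ v ∈ openCell D.normal D.offset k := by
  obtain ⟨v, hv⟩ := torusProj_surjective u.1
  exact ⟨v, _, hv, mem_openCell_floor (D.torusProj_mem_compl_iff.1 (hv ▸ u.2))⟩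

theorem mk_eq_mk_iff {u u' : ↥((⋃ H ∈ A.hyperplanes, H)ᶜ : Set (Torus n))} :
    (ConnectedComponents.mk u = ConnectedComponents.mk u') ↔
      connectedComponentIn (⋃ H ∈ A.hyperplanes, H)ᶜ u.1 =
        connectedComponentIn (⋃ H ∈ A.hyperplanes, H)ᶜ u'.1 := by
  rw [ConnectedComponents.coe_eq_coe, connectedComponentIn_eq_image u.2,
    connectedComponentIn_eq_image u'.2, Subtype.val_injective.image_injective.eq_iff]

theorem label_of_projected_cell_eq {k k' : A.hyperplanes → ℤ} {v : Fin n → ℝ}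
    (hv : v ∈ openCell D.normal D.offset k)
    (h : torusProj v ∈ torusProj '' openCell D.normal D.offset k') :
    ∃ z m, (∀ i, D.normal i z = m i) ∧ (∀ x, torusProj (x + z) = torusProj x) ∧ k' = k + m := by
  obtain ⟨w, hw, hwv⟩ := h
  obtain ⟨m, hm⟩ := D.exists_label_shift hwv.symm
  refine ⟨w - v, m, hm, fun x => ?_, ?_⟩
  · rw [← add_sub_assoc, add_comm, add_sub_assoc, torusProj_add, hwv, ← torusProj_add,
      add_sub_cancel]
  · have := add_mem_openCell hm hv
    rw [add_sub_cancel] at this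
    exact label_eq_of_mem_openCell hw this

/-- Each region has exactly one vertex at which a generic functional is minimal on a lift of the
region, and each vertex arises from exactly one region. -/
theorem nonempty_regions_equiv (D : A.Equations) (hgen : A.IsGeneralPosition)
    (hspan : A.IsSpanning) : Nonempty (A.Regions ≃ D.vertices) := by
  obtain ⟨ℓ, hℓ⟩ := exists_isGenericFor D.normal
  have hind := D.linearIndepOn_tightSet hgen
  refine nonempty_equiv_of_existsUnique (r := fun R p => ∃ u k x v, ConnectedComponents.mk u = R ∧
    torusProj x = u.1 ∧ x ∈ openCell D.normal D.offset k ∧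
    IsCellMin D.normal D.offset ℓ k v ∧ torusProj v = p.1) ?_ ?_ ?_ ?_
  · intro R
    obtain ⟨u, rfl⟩ := ConnectedComponents.surjective_coe R
    obtain ⟨x, k, hx, hxk⟩ := D.exists_lift u
    obtain ⟨v, hv⟩ := exists_isCellMin (ℓ := ℓ) (D.span_range_normal hgen hspan)
      ⟨x, openCell_subset_closedCell hxk⟩
    exact ⟨⟨torusProj v, v, rfl, hv.tight_span hℓ⟩, u, k, x, v, rfl, hx, hxk, hv, rfl⟩
  -- Two cells over one region differ by a lattice translation, which carries the minimiser of one
  -- to that of the other.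
  · rintro R p p' ⟨u, k, x, v, rfl, hx, hxk, hv, hp⟩ ⟨u', k', x', v', hR, hx', hxk', hv', hp'⟩
    rw [mk_eq_mk_iff, ← hx, ← hx', connectedComponentIn_compl hxk,
      connectedComponentIn_compl hxk'] at hR
    obtain ⟨z, m, hz, hzπ, rfl⟩ := label_of_projected_cell_eq hxk
      (hR ▸ mem_image_of_mem torusProj hxk)
    have := (isCellMin_add hz hv).eq hℓ hind hv'
    rw [← hzπ, this] at hp
    exact Subtype.ext (hp.symm.trans hp')
  · rintro ⟨_, v, rfl, hv⟩
    obtain ⟨k, ⟨x, hx⟩, hmin⟩ := exists_isCellMin_of_span_tightSet hℓ (hind v) hv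
    exact ⟨_, ⟨torusProj x, D.torusProj_mem_compl_iff.2 (tightSet_eq_empty_of_mem_openCell hx)⟩,
      k, x, v, rfl, rfl, hx, hmin, rfl⟩
  -- Translate until the two lifts of the vertex coincide; the cells then have the same label, so
  -- the regions agree.
  · rintro R R' p ⟨u, k, x, v, rfl, hx, hxk, hv, hp⟩ ⟨u', k', x', v', rfl, hx', hxk', hv', hp'⟩
    obtain ⟨m, hm⟩ := D.exists_label_shift (hp.trans hp'.symm)
    have h1 := isCellMin_add hm hv
    rw [add_sub_cancel] at h1
    obtain rfl := h1.label_eq hℓ hind hv'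
    have h2 := add_mem_openCell hm hxk
    rw [mk_eq_mk_iff, ← hx, ← hx', connectedComponentIn_compl hxk']
    have h3 : torusProj (x + (v' - v)) = torusProj x := by
      rw [← add_sub_assoc, add_comm, add_sub_assoc, torusProj_add, hp', ← hp, ← torusProj_add,
        add_sub_cancel]
    rw [← h3, connectedComponentIn_compl h2]

end Regions

end Equations

end ToricArrangement

theorem mainTheorem7 (n : ℕ) (A : ToricArrangement n)
    (hspan : A.IsSpanning) (hgen : A.IsGeneralPosition) :
    Finite A.Regions ∧ Finite A.IntersectionPoset ∧
      (A.numRegions : ℤ) = (-1) ^ n * A.charPoly.eval 0 := by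
  obtain ⟨D⟩ := A.nonempty_equations
  have hfin := A.finite_intersectionPoset
  obtain ⟨e⟩ := D.nonempty_regions_equiv hgen hspan
  obtain ⟨e'⟩ := D.nonempty_vertices_equiv
  refine ⟨Finite.of_equiv _ (e.trans e').symm, hfin, ?_⟩
  rw [D.neg_one_pow_mul_eval_charPoly hgen, ToricArrangement.numRegions, Nat.card_congr e]
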